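/- Let $m\ge 2$, let $\mathcal X_1,\dots,\mathcal X_m$ be finite sets, and let $X_{\mathcal M}=(X_1,\dots,X_m)$ be jointly distributed random variables with $X_i\in\mathcal X_i$, $\mathcal M=\{1,\dots,m\}$. Let $X_i^n$ be the observation of terminal $i$, where $X_{\mathcal M}^n$ consists of $n$ i.i.d. copies of $X_{\mathcal M}$; for $A\subseteq\mathcal M$ write $X_A=(X_i:i\in A)$. Logarithms and entropies are taken to a fixed base. *Multipartite information.* For jointly distributed finite-valued $Y_{\mathcal M}=(Y_1,\dots,Y_m)$, a finite-valued random variable $L$ on the same space, and a partition $\mathcal P$ of $\mathcal M$ with $|\mathcal P|\ge 2$ cells, put $$\Delta(\mathcal P)=\frac{\sum_{A\in\mathcal P}H(Y_A)-H(Y_{\mathcal M})}{|\mathcal P|-1},\qquad \Delta(\mathcal P|L)=\frac{\sum_{A\in\mathcal P}H(Y_A|L)-H(Y_{\mathcal M}|L)}{|\mathcal P|-1}.$$ Let $\mathbf I(Y_{\mathcal M})=\min_{\mathcal P}\Delta(\mathcal P)$, and let $\mathbf I(Y_{\mathcal M}|L)$ be the maximum of $\Delta(\mathcal P^*|L)$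 over all minimizers $\mathcal P^*$ of $\Delta$. *Communication.* An interactive communication (for block length $n$) is a finite tuple $\mathbf F=(F_1,\dots,F_r)$ of functions of $X_{\mathcal M}^n$ together with an assignment of a sending terminal to each $j$, such that $F_j$, if sent by terminal $i$, is a function only of $X_i^n$ and $F_1,\dots,F_{j-1}$. Its rate is $\frac1n\log|\mathcal F|$, where $\mathcal F$ is the support of $\mathbf F$. Given a sequence $\mathbf F=\mathbf F^{(n)}$ of interactive communications, a *common randomness (CR)* obtained from $\mathbf F$ is a sequence $\mathbf J=\mathbf J^{(n)}$ of functions of $X_{\mathcal M}^n$ such that for every $0<\epsilon<1$ and all sufficiently large $n$ there are $J_i=J_i(X_i^n,\mathbf F)$, $1\le i\le m$, with $\Pr[J_1=\dots=J_m=\mathbf J]\ge 1-\epsilon$. A *secret key (SK)* obtained from $\mathbf F$ is a CR $\mathbf K$ obtained from $\mathbf F$ such that $I(\mathbf K;\mathbf F)\to 0$ as $n\to\infty$. An *interactive common information (CI)* is a pair $(\mathbf J,\mathbf F)$, with $\mathbf J$ a CR obtained from $\mathbf F$, such that $\frac1n\mathbf I(X_{\mathcal M}^n|\mathbf J,\mathbf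 F)\to0$ as $n\to\infty$. *Rates.* Each of the following is the infimum, in $[0,\infty]$, of the real numbers $R\ge 0$ with the stated property. * $R_{\mathrm{SK}}$ (the communication complexity of achieving SK capacity): for every $\epsilon>0$ there are a sequence $\mathbf F$ of interactive communications and an SK $\mathbf K$ obtained from $\mathbf F$ such that, for all sufficiently large $n$, $\frac1n\log|\mathcal F|\le R+\epsilon$ and $\frac1nH(\mathbf K)\ge\mathbf I(X_{\mathcal M})-\epsilon$. * $R_{\mathrm{CI}}$: for every $\epsilon>0$ there is a CI $(\mathbf J,\mathbf F)$ such that $\frac1n\log|\mathcal F|\le R+\epsilon$ for all sufficiently large $n$. * $\mathrm{CI}(X_{\mathcal M})$: there is a CI $(\mathbf J,\mathbf F)$ such that, for every $\epsilon>0$, $\frac1nH(\mathbf J,\mathbf F)\le R+\epsilon$ for all sufficiently large $n$. **Theorem.** For every such source, $$R_{\mathrm{SK}}\ \ge\ R_{\mathrm{CI}}\ \ge\ \mathrm{CI}(X_{\mathcal M})-\mathbf I(X_{\mathcal M}).$$ -/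

import Mathlib

open Filter Topology

noncomputable section

namespace MTSource

/-! ### Entropy of finite-valued random variables

The sample space `Ω` is finite with probability mass function `p`, and a random variable is a
function on `Ω`. Logarithms are natural; every notion below scales with the choice of base. -/

section Entropy

variable {Ω : Type*} [Fintype Ω]

open Classical in
/-- Probability of the event `E`. -/
def prob (p : PMF Ω) (E : Ω → Prop) : ℝ := ∑ x with E x, (p x).toReal

open Classical in
/-- Shannon entropy `H(f)`: the sum of `- P(f = s) log P(f = s)` over the values `s` of `f`
(with `0 log 0 = 0`). -/
def entropy (p : PMF Ω) {S : Type*} (f : Ω → S) : ℝ :=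
  ∑ s ∈ Finset.univ.image f, Real.negMulLog (prob p fun x => f x = s)

/-- Conditional entropy `H(f | g) = H(f, g) - H(g)`. -/
def condEntropy (p : PMF Ω) {S T : Type*} (f : Ω → S) (g : Ω → T) : ℝ :=
  entropy p (fun x => (f x, g x)) - entropy p g

/-- Mutual information `I(f ; g) = H(f) - H(f | g)`. -/
def mutualInfo (p : PMF Ω) {S T : Type*} (f : Ω → S) (g : Ω → T) : ℝ :=
  entropy p f - condEntropy p f g

end Entropy

/-! ### Multipartite information of a collection `Y = (Y i : i ∈ {1, …, m})` -/

section Multipartite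

variable {Ω : Type*} [Fintype Ω] {m : ℕ} {𝒴 : Fin m → Type*}

/-- The subcollection `Y_A = (Y i : i ∈ A)`. -/
def restr (Y : ∀ i, Ω → 𝒴 i) (A : Finset (Fin m)) : Ω → ∀ i : A, 𝒴 i :=
  fun x i => Y i x

/-- `Δ(P) = (∑_{A ∈ P} H(Y_A) - H(Y_M)) / (|P| - 1)`. -/
def delta (p : PMF Ω) (Y : ∀ i, Ω → 𝒴 i)
    (P : Finpartition (Finset.univ : Finset (Fin m))) : ℝ :=
  (∑ A ∈ P.parts, entropy p (restr Y A) - entropy p (restr Y Finset.univ)) /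
    ((P.parts.card : ℝ) - 1)

/-- `Δ(P | L) = (∑_{A ∈ P} H(Y_A | L) - H(Y_M | L)) / (|P| - 1)`. -/
def condDelta (p : PMF Ω) (Y : ∀ i, Ω → 𝒴 i) {S : Type*} (L : Ω → S)
    (P : Finpartition (Finset.univ : Finset (Fin m))) : ℝ :=
  (∑ A ∈ P.parts, condEntropy p (restr Y A) L - condEntropy p (restr Y Finset.univ) L) /
    ((P.parts.card : ℝ) - 1)

/-- Multipartite information: the minimum of `Δ(P)` over the partitions with at least two cells
(a finite set of partitions, nonempty for `m ≥ 2`). -/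
def multiInfo (p : PMF Ω) (Y : ∀ i, Ω → 𝒴 i) : ℝ :=
  sInf {d : ℝ | ∃ P : Finpartition (Finset.univ : Finset (Fin m)),
    2 ≤ P.parts.card ∧ d = delta p Y P}

/-- `P` has at least two cells and minimizes `Δ` among all such partitions. -/
def IsMinimizer (p : PMF Ω) (Y : ∀ i, Ω → 𝒴 i)
    (P : Finpartition (Finset.univ : Finset (Fin m))) : Prop :=
  2 ≤ P.parts.card ∧
    ∀ Q : Finpartition (Finset.univ : Finset (Fin m)), 2 ≤ Q.parts.card →
      delta p Y P ≤ delta p Y Q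

/-- Conditional multipartite information given `L`: the maximum of `Δ(P | L)` over the
(finitely many) minimizers `P` of the unconditional `Δ`. -/
def condMultiInfo (p : PMF Ω) (Y : ∀ i, Ω → 𝒴 i) {S : Type*} (L : Ω → S) : ℝ :=
  sSup {d : ℝ | ∃ P : Finpartition (Finset.univ : Finset (Fin m)),
    IsMinimizer p Y P ∧ d = condDelta p Y L P}

end Multipartite

/-! ### The multiterminal source model

A source is a joint probability mass function `p` on `∀ i, 𝒳 i`, the `𝒳 i` being finite. -/

section Source

variable {m : ℕ}

/-- The possible values of `X_M^n`: at each time, one letter for every terminal. -/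
abbrev Obs (𝒳 : Fin m → Type*) (n : ℕ) : Type _ := Fin n → ∀ i, 𝒳 i

/-- The observation `X_i^n` of terminal `i`. -/
def own {𝒳 : Fin m → Type*} {n : ℕ} (i : Fin m) (x : Obs 𝒳 n) : Fin n → 𝒳 i :=
  fun t => x t i

/-- An interactive communication with `r` transmissions: the `j`-th one, sent by terminal
`sender j`, is a function only of that terminal's observation and of the earlier transmissions.
Each transmission takes finitely many values; they are encoded as natural numbers. -/
structure InteractiveComm (𝒳 : Fin m → Type*) (n : ℕ) where
  r : ℕ
  sender : Fin r → Fin m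
  F : Obs 𝒳 n → Fin r → ℕ
  interactive : ∀ (j : Fin r) (x y : Obs 𝒳 n),
    own (sender j) x = own (sender j) y → (∀ k < j, F x k = F y k) → F x j = F y j

variable {𝒳 : Fin m → Type*} [∀ i, Fintype (𝒳 i)]

/-- The law of `n` i.i.d. copies of `X_M`. -/
def iid (p : PMF (∀ i, 𝒳 i)) (n : ℕ) : PMF (Obs 𝒳 n) :=
  PMF.ofFintype (fun x => ∏ t, p (x t)) (by
    classical
    have h1 : ∑ a, p a = 1 := by simpa [tsum_fintype] using p.tsum_coe
    have h := Finset.prod_univ_sum (fun _ : Fin n => (Finset.univ : Finset (∀ i, 𝒳 i)))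
      (fun _ a => p a)
    rw [Fintype.piFinset_univ] at h
    rw [← h]
    simp [h1])

/-- The multipartite information of the source `X_M`. -/
def sourceInfo (p : PMF (∀ i, 𝒳 i)) : ℝ :=
  multiInfo p (fun i (x : ∀ i, 𝒳 i) => x i)

/-- The rate `(1/n) log |𝓕|`, where `𝓕` is the support of the random variable `F`. -/
def commRate (p : PMF (∀ i, 𝒳 i)) {n : ℕ} (c : InteractiveComm 𝒳 n) : ℝ :=
  Real.log ((c.F '' (iid p n).support).ncard : ℝ) / n

/-- `J` is a common randomness obtained from the interactive communication `c`: for large `n`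
each terminal `i` can compute some `J_i` from its observation and the communication, such that
`J_1 = ⋯ = J_m = J` with probability at least `1 - ε`. Here `J n` is a function of `X_M^n`; its
finitely many values are encoded as natural numbers. -/
def IsCR (p : PMF (∀ i, 𝒳 i)) (c : ∀ n, InteractiveComm 𝒳 n)
    (J : ∀ n, Obs 𝒳 n → ℕ) : Prop :=
  ∀ ε : ℝ, 0 < ε → ε < 1 → ∀ᶠ n in atTop,
    ∃ g : ∀ i : Fin m, (Fin n → 𝒳 i) → (Fin (c n).r → ℕ) → ℕ,
      1 - ε ≤ prob (iid p n) (fun x => ∀ i, g i (own i x) ((c n).F x) = J n x)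

/-- `K` is a secret key obtained from `c`: a common randomness with `I(K ; F) → 0`. -/
def IsSK (p : PMF (∀ i, 𝒳 i)) (c : ∀ n, InteractiveComm 𝒳 n)
    (K : ∀ n, Obs 𝒳 n → ℕ) : Prop :=
  IsCR p c K ∧ ∀ ε : ℝ, 0 < ε → ∀ᶠ n in atTop, mutualInfo (iid p n) (K n) (c n).F ≤ ε

/-- `L` is a (multiterminal) Wyner common information: `(1/n) I(X_M^n | L) → 0`. -/
def IsWynerCI (p : PMF (∀ i, 𝒳 i)) {S : ℕ → Type*} (L : ∀ n, Obs 𝒳 n → S n) : Prop :=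
  Tendsto (fun n : ℕ => condMultiInfo (iid p n) own (L n) / n) atTop (𝓝 0)

/-- The pair `(J, F)`. -/
def pairJF (c : ∀ n, InteractiveComm 𝒳 n) (J : ∀ n, Obs 𝒳 n → ℕ) (n : ℕ) :
    Obs 𝒳 n → ℕ × (Fin (c n).r → ℕ) :=
  fun x => (J n x, (c n).F x)

/-- `(J, F)` is an interactive common information. -/
def IsCI (p : PMF (∀ i, 𝒳 i)) (c : ∀ n, InteractiveComm 𝒳 n)
    (J : ∀ n, Obs 𝒳 n → ℕ) : Prop :=
  IsCR p c J ∧ IsWynerCI p (pairJF c J)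

/-- `R` is an achievable rate of interactive communication for maximal-rate secret key. -/
def AchievableRSK (p : PMF (∀ i, 𝒳 i)) (R : ℝ) : Prop :=
  0 ≤ R ∧ ∀ ε : ℝ, 0 < ε →
    ∃ (c : ∀ n, InteractiveComm 𝒳 n) (K : ∀ n, Obs 𝒳 n → ℕ), IsSK p c K ∧
      ∀ᶠ n : ℕ in atTop, commRate p (c n) ≤ R + ε ∧
        sourceInfo p - ε ≤ entropy (iid p n) (K n) / n

/-- `R` is an achievable rate of interactive communication for interactive common information. -/
def AchievableRCI (p : PMF (∀ i, 𝒳 i)) (R : ℝ) : Prop :=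
  0 ≤ R ∧ ∀ ε : ℝ, 0 < ε →
    ∃ (c : ∀ n, InteractiveComm 𝒳 n) (J : ∀ n, Obs 𝒳 n → ℕ), IsCI p c J ∧
      ∀ᶠ n : ℕ in atTop, commRate p (c n) ≤ R + ε

/-- `R` is an achievable rate of interactive common information. -/
def AchievableCI (p : PMF (∀ i, 𝒳 i)) (R : ℝ) : Prop :=
  0 ≤ R ∧ ∃ (c : ∀ n, InteractiveComm 𝒳 n) (J : ∀ n, Obs 𝒳 n → ℕ), IsCI p c J ∧
    ∀ ε : ℝ, 0 < ε → ∀ᶠ n : ℕ in atTop,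
      entropy (iid p n) (pairJF c J n) / n ≤ R + ε

/-- The communication complexity `R_SK` of achieving secret key capacity. Infima of rates are
taken in the extended reals, so that an empty set of rates would give `+∞`. -/
def RSK (p : PMF (∀ i, 𝒳 i)) : EReal :=
  sInf {R : EReal | ∃ R' : ℝ, AchievableRSK p R' ∧ R = (R' : EReal)}

/-- `R_CI`, the infimum of the achievable rates of interactive communication for interactive
common information. -/
def RCI (p : PMF (∀ i, 𝒳 i)) : EReal :=
  sInf {R : EReal | ∃ R' : ℝ, AchievableRCI p R' ∧ R = (R' : EReal)}

/-- `CI(X_M)`, the minimum rate of interactive common information. -/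
def CIrate (p : PMF (∀ i, 𝒳 i)) : EReal :=
  sInf {R : EReal | ∃ R' : ℝ, AchievableCI p R' ∧ R = (R' : EReal)}

end Source

end MTSource

end

/-! Both inequalities come from one estimate, `entropy_pair_sub_le`. Let `L = (J, F)`, where every
terminal recovers `J` from `F` and its own observation up to equivocation `η`. Then, for each
partition `P` with at least two cells, `H(J | F) ≤ Δ(P) - Δ(P | L) + 2η`.

To see this, add up `I(X_A ; L) = H(L) - H(L | X_A)` over the cells. Recoverability replaces `H(L |
X_A)` by `H(F | X_A) + η`. Interactivity gives `∑ H(F | X_A) ≤ (|P| - 1) H(F)`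
(`sum_condEntropy_comm_le`). Subtracting `I(X_M ; L) = H(L)` and dividing by `|P| - 1` gives the
estimate. Fano's inequality makes `η` small compared with `n`, and `Δ` scales by `n` on i.i.d.
blocks.

A secret key of nearly maximal rate has `H(K | F)` close to `n I(X_M)`, which is `Δ(P)` for a block
minimizer `P`. Hence `Δ(P | K, F)` is `o(n)` along a diagonal sequence, and `(K, F)` is a CI with
the same communication rate. For the second inequality, drop `Δ(P | L) ≥ 0` and bound `H(F)` by `log
|𝓕|`: this gives `H(J, F) ≤ log |𝓕| + n I(X_M) + o(n)`. -/

namespace MTSource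

/-! ### Shannon inequalities, all derived from Gibbs' inequality or from comparing level sets. -/

section Entropy

variable {Ω : Type*} [Fintype Ω] {S T U : Type*}

theorem sum_toReal_eq_one (p : PMF Ω) : ∑ x, (p x).toReal = 1 := by
  have h : ∑ x, p x = 1 := by simpa [tsum_fintype] using p.tsum_coe
  rw [← ENNReal.toReal_sum fun x _ => p.apply_ne_top x, h, ENNReal.toReal_one]

theorem prob_nonneg (p : PMF Ω) (E : Ω → Prop) : 0 ≤ prob p E :=
  Finset.sum_nonneg fun _ _ => ENNReal.toReal_nonneg

open Classical in
theorem prob_eq_sum_ite (p : PMF Ω) (E : Ω → Prop) :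
    prob p E = ∑ x, if E x then (p x).toReal else 0 := by
  rw [prob, Finset.sum_filter]

theorem prob_mono (p : PMF Ω) {E E' : Ω → Prop} (h : ∀ x, E x → E' x) :
    prob p E ≤ prob p E' := by
  classical
  simp only [prob_eq_sum_ite]
  refine Finset.sum_le_sum fun x _ => ?_
  have := ENNReal.toReal_nonneg (a := p x)
  by_cases hE : E x
  · simp [hE, h x hE]
  · simp only [hE, if_false]; split_ifs <;> linarith

theorem prob_add_prob_not (p : PMF Ω) (E : Ω → Prop) :
    prob p E + prob p (fun x => ¬ E x) = 1 := by
  classical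
  simp only [prob]
  rw [← sum_toReal_eq_one p]
  exact Finset.sum_filter_add_sum_filter_not _ _ _

theorem le_prob (p : PMF Ω) {E : Ω → Prop} {x : Ω} (hx : E x) : (p x).toReal ≤ prob p E := by
  classical
  exact Finset.single_le_sum (f := fun x => (p x).toReal)
    (fun _ _ => ENNReal.toReal_nonneg) (by simp [hx])

theorem sum_toReal_mul_comp [DecidableEq S] (p : PMF Ω) (f : Ω → S) (φ : S → ℝ) :
    ∑ x, (p x).toReal * φ (f x) =
      ∑ s ∈ Finset.univ.image f, prob p (fun x => f x = s) * φ s := by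
  rw [← Finset.sum_fiberwise_of_maps_to (t := Finset.univ.image f) (g := f)
    (fun x _ => Finset.mem_image_of_mem f (Finset.mem_univ x))]
  refine Finset.sum_congr rfl fun s _ => ?_
  rw [prob, Finset.sum_mul]
  refine Finset.sum_congr (by ext; simp) fun x hx => ?_
  rw [show f x = s by simpa using hx]

theorem entropy_eq_sum (p : PMF Ω) (f : Ω → S) :
    entropy p f = ∑ x, (p x).toReal * -Real.log (prob p fun y => f y = f x) := by
  classical
  rw [sum_toReal_mul_comp p f fun s => -Real.log (prob p fun y => f y = s), entropy]
  refine Finset.sum_congr (by ext; simp) fun s _ => ?_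
  rw [Real.negMulLog]; ring

/-- Gibbs' inequality: the entropy is at most the cross entropy relative to any subprobability. -/
theorem entropy_le_crossEntropy [DecidableEq S] (p : PMF Ω) (f : Ω → S) (r : S → ℝ) (hr : ∀ s, 0 ≤ r s)
    (hpos : ∀ x, 0 < (p x).toReal → 0 < r (f x)) (hsum : ∑ s ∈ Finset.univ.image f, r s ≤ 1) :
    entropy p f ≤ ∑ x, (p x).toReal * -Real.log (r (f x)) := by
  rw [entropy_eq_sum, sum_toReal_mul_comp p f fun s => -Real.log (prob p fun y => f y = s),
    sum_toReal_mul_comp p f fun s => -Real.log (r s)]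
  have h1 : ∑ s ∈ Finset.univ.image f, prob p (fun x => f x = s) = 1 := by
    have := sum_toReal_mul_comp p f fun _ => 1
    simpa [sum_toReal_eq_one] using this.symm
  -- Termwise, `log t ≤ t - 1` at `t = r s / P(f = s)`; the correction terms sum to at most `1 - 1 =
  -- 0`.
  have key : ∀ s ∈ Finset.univ.image f,
      prob p (fun x => f x = s) * -Real.log (prob p fun y => f y = s) ≤
        prob p (fun x => f x = s) * -Real.log (r s) + (r s - prob p fun x => f x = s) := by
    intro s _
    rcases (prob_nonneg p fun x => f x = s).eq_or_lt with h0 | h0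
    · rw [← h0]; simpa using hr s
    · have hrs : 0 < r s := by
        classical
        by_contra hcon
        refine h0.ne' ?_
        refine Finset.sum_eq_zero fun x hx => ?_
        by_contra hx0
        have := hpos x (lt_of_le_of_ne ENNReal.toReal_nonneg (Ne.symm hx0))
        rw [show f x = s by simpa using hx] at this
        exact hcon this
      have hlog := Real.log_le_sub_one_of_pos (div_pos hrs h0)
      rw [Real.log_div hrs.ne' h0.ne'] at hlog
      have := mul_le_mul_of_nonneg_left hlog h0.le
      have e : (prob p fun x => f x = s) * (r s / (prob p fun x => f x = s) - 1) =
        r s - prob p fun x => f x = s := by field_simp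
      rw [e] at this
      linarith
  have := Finset.sum_le_sum key
  rw [Finset.sum_add_distrib, Finset.sum_sub_distrib, h1] at this
  linarith

/-- Entropy sees only the partition of `Ω` into level sets, so "`f` is a function of `g`" is
expressed by inclusion of kernels. Each fibre of `g` lies in a fibre of `f`, which gives a pointwise
comparison of logarithms. -/
theorem entropy_mono (p : PMF Ω) {f : Ω → S} {g : Ω → T}
    (h : ∀ x y, g x = g y → f x = f y) : entropy p f ≤ entropy p g := by
  rw [entropy_eq_sum, entropy_eq_sum]
  refine Finset.sum_le_sum fun x _ => ?_
  rcases (ENNReal.toReal_nonneg (a := p x)).eq_or_lt with h0 | h0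
  · simp [← h0]
  · have hg : 0 < prob p fun y => g y = g x := h0.trans_le (le_prob p rfl)
    have := Real.log_le_log hg (prob_mono p (E := fun y => g y = g x)
      (E' := fun y => f y = f x) fun y hy => h y x hy)
    exact mul_le_mul_of_nonneg_left (by linarith) h0.le

theorem entropy_congr (p : PMF Ω) {f : Ω → S} {g : Ω → T}
    (h : ∀ x y, f x = f y ↔ g x = g y) : entropy p f = entropy p g :=
  le_antisymm (entropy_mono p fun x y => (h x y).2) (entropy_mono p fun x y => (h x y).1)

theorem sum_prob_and [DecidableEq S] (p : PMF Ω) (E : Ω → Prop) (f : Ω → S) :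
    ∑ s ∈ Finset.univ.image f, prob p (fun x => f x = s ∧ E x) = prob p E := by
  classical
  simp only [prob_eq_sum_ite]
  rw [Finset.sum_comm]
  refine Finset.sum_congr rfl fun x _ => ?_
  rw [Finset.sum_eq_single (f x)]
  · simp
  · intro s _ hs; simp [Ne.symm hs]
  · intro hx; exact absurd (Finset.mem_image_of_mem f (Finset.mem_univ x)) hx

/-- This is Gibbs' inequality relative to the law `P(s,u) P(t,u) / P(u)`, which makes `f` and `g`
conditionally independent given `h`. -/
theorem entropy_submodular (p : PMF Ω) (f : Ω → S) (g : Ω → T) (h : Ω → U) :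
    entropy p (fun x => (f x, g x, h x)) + entropy p h ≤
      entropy p (fun x => (f x, h x)) + entropy p (fun x => (g x, h x)) := by
  classical
  set a : S → U → ℝ := fun s u => prob p fun x => f x = s ∧ h x = u with ha
  set b : T → U → ℝ := fun t u => prob p fun x => g x = t ∧ h x = u with hb
  set q : U → ℝ := fun u => prob p fun x => h x = u with hq
  have hapos : ∀ x, 0 < (p x).toReal → 0 < a (f x) (h x) :=
    fun x hx => hx.trans_le (le_prob p ⟨rfl, rfl⟩)
  have hbpos : ∀ x, 0 < (p x).toReal → 0 < b (g x) (h x) :=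
    fun x hx => hx.trans_le (le_prob p ⟨rfl, rfl⟩)
  have hqpos : ∀ x, 0 < (p x).toReal → 0 < q (h x) :=
    fun x hx => hx.trans_le (le_prob p rfl)
  have hr : ∀ s t u, 0 ≤ a s u * b t u / q u := fun s t u =>
    div_nonneg (mul_nonneg (prob_nonneg _ _) (prob_nonneg _ _)) (prob_nonneg _ _)
  have hq1 : ∑ u ∈ Finset.univ.image h, q u = 1 := by
    have := sum_prob_and p (fun _ => True) h
    simp only [and_true] at this
    rw [hq, this, prob]; simp [sum_toReal_eq_one]
  have gibbs := entropy_le_crossEntropy p (fun x => (f x, g x, h x))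
    (fun z => a z.1 z.2.2 * b z.2.1 z.2.2 / q z.2.2) (fun z => hr _ _ _)
    (fun x hx => div_pos (mul_pos (hapos x hx) (hbpos x hx)) (hqpos x hx)) (by
      calc _ ≤ ∑ z ∈ Finset.univ.image f ×ˢ Finset.univ.image g ×ˢ Finset.univ.image h,
            a z.1 z.2.2 * b z.2.1 z.2.2 / q z.2.2 := by
            refine Finset.sum_le_sum_of_subset_of_nonneg ?_ fun z _ _ => hr _ _ _
            intro z hz
            obtain ⟨x, -, rfl⟩ := Finset.mem_image.1 hz
            simp
        _ = ∑ u ∈ Finset.univ.image h, (∑ s ∈ Finset.univ.image f, a s u) *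
              (∑ t ∈ Finset.univ.image g, b t u) / q u := by
            rw [Finset.sum_product, Finset.sum_congr rfl fun s _ => Finset.sum_product_right _ _ _,
              Finset.sum_comm]
            refine Finset.sum_congr rfl fun u _ => ?_
            rw [Finset.sum_mul_sum, Finset.sum_div]
            exact Finset.sum_congr rfl fun s _ => by rw [Finset.sum_div]
        _ = ∑ u ∈ Finset.univ.image h, q u := by
            refine Finset.sum_congr rfl fun u _ => ?_
            rw [ha, hb, sum_prob_and p (fun x => h x = u) f, sum_prob_and p (fun x => h x = u) g]
            -- Valid also when `q u = 0`, since division by zero gives zero.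
            exact mul_self_div_self _
        _ ≤ 1 := hq1.le)
  have hsplit : ∑ x, (p x).toReal * -Real.log (a (f x) (h x) * b (g x) (h x) / q (h x)) =
      entropy p (fun x => (f x, h x)) + entropy p (fun x => (g x, h x)) - entropy p h := by
    rw [entropy_eq_sum, entropy_eq_sum, entropy_eq_sum, ← Finset.sum_add_distrib,
      ← Finset.sum_sub_distrib]
    refine Finset.sum_congr rfl fun x _ => ?_
    rcases (ENNReal.toReal_nonneg (a := p x)).eq_or_lt with h0 | h0
    · simp [← h0]
    · rw [Real.log_div (mul_pos (hapos x h0) (hbpos x h0)).ne' (hqpos x h0).ne',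
        Real.log_mul (hapos x h0).ne' (hbpos x h0).ne']
      simp only [ha, hb, hq, Prod.mk.injEq]
      ring
  linarith

theorem condEntropy_le_of_determines (p : PMF Ω) (f : Ω → S) {g : Ω → T} {h : Ω → U}
    (hgh : ∀ x y, g x = g y → h x = h y) : condEntropy p f g ≤ condEntropy p f h := by
  have h1 := entropy_submodular p f g h
  have h2 : entropy p (fun x => (f x, g x, h x)) = entropy p (fun x => (f x, g x)) :=
    entropy_congr p fun x y => by
      simp only [Prod.mk.injEq]
      exact ⟨fun e => ⟨e.1, e.2.1⟩, fun e => ⟨e.1, e.2, hgh _ _ e.2⟩⟩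
  have h3 : entropy p (fun x => (g x, h x)) = entropy p g :=
    entropy_congr p fun x y => by
      simp only [Prod.mk.injEq]
      exact ⟨fun e => e.1, fun e => ⟨e, hgh _ _ e⟩⟩
  simp only [condEntropy]
  linarith

theorem condEntropy_pair_le (p : PMF Ω) (f : Ω → S) (g : Ω → T) (h : Ω → U) :
    condEntropy p (fun x => (f x, g x)) h ≤ condEntropy p f h + condEntropy p g h := by
  have h1 := entropy_submodular p f g h
  have h2 : entropy p (fun x => ((f x, g x), h x)) = entropy p (fun x => (f x, g x, h x)) :=
    entropy_congr p fun x y => by simp only [Prod.mk.injEq, and_assoc]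
  simp only [condEntropy]
  linarith

theorem condEntropy_mono (p : PMF Ω) {f : Ω → S} {g : Ω → T} (h : Ω → U)
    (hfg : ∀ x y, g x = g y → f x = f y) : condEntropy p f h ≤ condEntropy p g h := by
  refine sub_le_sub_right (entropy_mono p fun x y e => ?_) _
  simp only [Prod.mk.injEq] at e ⊢
  exact ⟨hfg _ _ e.1, e.2⟩

theorem entropy_const (p : PMF Ω) (f : Ω → S) (hf : ∀ x y, f x = f y) : entropy p f = 0 := by
  rw [entropy_eq_sum]
  refine Finset.sum_eq_zero fun x _ => ?_
  have : (prob p fun y => f y = f x) = 1 := by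
    rw [show (fun y => f y = f x) = fun _ => True from funext fun y => by simp [hf y x], prob]
    simp [sum_toReal_eq_one]
  simp [this]

theorem condEntropy_const (p : PMF Ω) (f : Ω → S) {g : Ω → T} (hg : ∀ x y, g x = g y) :
    condEntropy p f g = entropy p f := by
  rw [condEntropy, entropy_const p g hg, sub_zero]
  exact entropy_congr p fun x y => by simp [hg x y]

theorem condEntropy_le_entropy (p : PMF Ω) (f : Ω → S) (g : Ω → T) :
    condEntropy p f g ≤ entropy p f := by
  rw [← condEntropy_const p f (g := fun _ => ()) fun _ _ => rfl]
  exact condEntropy_le_of_determines p f fun _ _ _ => rfl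

/-- Gibbs' inequality relative to the uniform law on the values taken with positive probability. -/
theorem entropy_le_log_ncard (p : PMF Ω) (f : Ω → S) :
    entropy p f ≤ Real.log ((f '' p.support).ncard : ℝ) := by
  classical
  have hfin : (f '' p.support).Finite := Set.toFinite _
  obtain ⟨x₀, hx₀⟩ := p.support_nonempty
  have hN : 0 < (f '' p.support).ncard := (Set.ncard_pos hfin).2 ⟨_, x₀, hx₀, rfl⟩
  have hN' : (0 : ℝ) < (f '' p.support).ncard := by exact_mod_cast hN
  have gibbs := entropy_le_crossEntropy p f
    (fun s => if s ∈ f '' p.support then ((f '' p.support).ncard : ℝ)⁻¹ else 0)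
    (fun s => by split_ifs <;> positivity)
    (fun x hx => by
      have : x ∈ p.support := by
        rw [PMF.mem_support_iff]; intro h0; simp [h0] at hx
      rw [if_pos ⟨x, this, rfl⟩]; positivity)
    (by
      rw [← Finset.sum_filter, Finset.sum_const, nsmul_eq_mul, ← div_eq_mul_inv, div_le_one hN']
      rw [Set.ncard_eq_toFinset_card _ hfin]
      exact_mod_cast Finset.card_le_card fun s hs => by
        rw [Set.Finite.mem_toFinset]; exact (Finset.mem_filter.1 hs).2)
  refine gibbs.trans (le_of_eq ?_)
  rw [← one_mul (Real.log ((f '' p.support).ncard : ℝ)), ← sum_toReal_eq_one p, Finset.sum_mul]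
  refine Finset.sum_congr rfl fun x _ => ?_
  by_cases hx : p x = 0
  · simp [hx]
  · rw [if_pos ⟨x, (PMF.mem_support_iff _ _).2 hx, rfl⟩, Real.log_inv, neg_neg]

/-- Fano's inequality, in a weak form: `f` coincides with a function of `g` off the event `E`. -/
theorem condEntropy_le_of_prob_error (p : PMF Ω) (f : Ω → S) (g : Ω → T) (E : Ω → Prop)
    (hE : ∀ x y, ¬ E x → ¬ E y → g x = g y → f x = f y) :
    condEntropy p f g ≤ Real.log 2 + prob p E * Real.log (Fintype.card Ω) := by
  classical
  obtain ⟨x₀, -⟩ := p.support_nonempty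
  have : Nonempty Ω := ⟨x₀⟩
  have hN : (0 : ℝ) < Fintype.card Ω := by exact_mod_cast Fintype.card_pos
  -- `f'` keeps `f` only on the error event; together with `g` it determines `f`.
  set f' : Ω → Option S := fun x => if E x then some (f x) else none with hf'
  have h1 : condEntropy p f g ≤ condEntropy p f' g := by
    refine sub_le_sub_right (entropy_mono p fun x y e => ?_) _
    simp only [Prod.mk.injEq, hf'] at e ⊢
    refine ⟨?_, e.2⟩
    by_cases hx : E x <;> by_cases hy : E y <;> simp only [hx, hy, if_true, if_false] at e
    · exact Option.some_injective _ e.1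
    · exact absurd e.1 (by simp)
    · exact absurd e.1 (by simp)
    · exact hE x y hx hy e.2
  have h2 := condEntropy_le_entropy p f' g
  -- The reference law puts mass 1/2 on `none` and `1 / (2 |Ω|)` on each other value, so its cross
  -- entropy is exactly the claimed bound.
  have gibbs := entropy_le_crossEntropy p f'
    (fun s => if s = none then 2⁻¹ else 2⁻¹ * (Fintype.card Ω : ℝ)⁻¹)
    (fun s => by split_ifs <;> positivity)
    (fun x _ => by split_ifs <;> positivity)
    (by
      calc _ ≤ ∑ s ∈ insert none ((Finset.univ.image f).image some),
            (if s = none then 2⁻¹ else 2⁻¹ * (Fintype.card Ω : ℝ)⁻¹) := by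
            refine Finset.sum_le_sum_of_subset_of_nonneg ?_
              fun _ _ _ => by split_ifs <;> positivity
            intro s hs
            obtain ⟨x, -, rfl⟩ := Finset.mem_image.1 hs
            by_cases hx : E x <;> simp [hf', hx]
        _ = 2⁻¹ + (Finset.univ.image f).card * (2⁻¹ * (Fintype.card Ω : ℝ)⁻¹) := by
            rw [Finset.sum_insert (by simp), Finset.sum_image (by simp)]
            simp
        _ ≤ 2⁻¹ + Fintype.card Ω * (2⁻¹ * (Fintype.card Ω : ℝ)⁻¹) := by
            gcongr
            exact Finset.card_image_le
        _ = 1 := by field_simp; norm_num)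
  have h3 : ∑ x, (p x).toReal *
        -Real.log (if f' x = none then 2⁻¹ else 2⁻¹ * (Fintype.card Ω : ℝ)⁻¹) =
      Real.log 2 + prob p E * Real.log (Fintype.card Ω) := by
    rw [← one_mul (Real.log 2), ← sum_toReal_eq_one p, prob_eq_sum_ite, Finset.sum_mul,
      Finset.sum_mul, ← Finset.sum_add_distrib]
    refine Finset.sum_congr rfl fun x _ => ?_
    by_cases hx : E x
    · simp only [hf', hx, if_true, reduceCtorEq, if_false]
      rw [Real.log_mul (by norm_num) (by positivity), Real.log_inv, Real.log_inv]
      ring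
    · simp [hf', hx]
  linarith

end Entropy

/-! ### Nonnegativity of `Δ` and existence of minimizing partitions. -/

section Multipartite

variable {Ω : Type*} [Fintype Ω] {m : ℕ} {𝒴 : Fin m → Type*} {S : Type*}

theorem restr_eq_iff {Ω : Type*} {Y : ∀ i, Ω → 𝒴 i} {A : Finset (Fin m)} {x y : Ω} :
    restr Y A x = restr Y A y ↔ ∀ i ∈ A, Y i x = Y i y := by
  simp [restr, funext_iff]

theorem condEntropy_restr_sup_le (p : PMF Ω) (Y : ∀ i, Ω → 𝒴 i) (L : Ω → S)
    (Q : Finset (Finset (Fin m))) :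
    condEntropy p (restr Y (Q.sup id)) L ≤ ∑ A ∈ Q, condEntropy p (restr Y A) L := by
  induction Q using Finset.induction_on with
  | empty =>
    rw [Finset.sum_empty, condEntropy]
    refine sub_nonpos.2 (entropy_mono p fun x y h => ?_)
    rw [Prod.mk.injEq, restr_eq_iff]
    simp [h]
  | insert A Q hA ih =>
    rw [Finset.sum_insert hA]
    have h1 := condEntropy_pair_le p (restr Y A) (restr Y (Q.sup id)) L
    have h2 : condEntropy p (restr Y ((insert A Q).sup id)) L ≤
        condEntropy p (fun x => (restr Y A x, restr Y (Q.sup id) x)) L := by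
      refine condEntropy_mono p L fun x y h => ?_
      rw [Prod.mk.injEq, restr_eq_iff, restr_eq_iff] at h
      rw [restr_eq_iff]
      intro i hi
      rw [Finset.sup_insert] at hi
      rcases Finset.mem_union.1 hi with hi | hi
      · exact h.1 i hi
      · exact h.2 i hi
    linarith

theorem condDelta_nonneg (p : PMF Ω) (Y : ∀ i, Ω → 𝒴 i) (L : Ω → S)
    {P : Finpartition (Finset.univ : Finset (Fin m))} (hP : 2 ≤ P.parts.card) :
    0 ≤ condDelta p Y L P := by
  have h := condEntropy_restr_sup_le p Y L P.parts
  rw [P.sup_parts] at h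
  have : (2 : ℝ) ≤ P.parts.card := by exact_mod_cast hP
  exact div_nonneg (by linarith) (by linarith)

theorem delta_nonneg (p : PMF Ω) (Y : ∀ i, Ω → 𝒴 i)
    {P : Finpartition (Finset.univ : Finset (Fin m))} (hP : 2 ≤ P.parts.card) :
    0 ≤ delta p Y P := by
  have h := condDelta_nonneg p Y (fun _ => ()) hP
  simpa only [condDelta, condEntropy_const p _ (g := fun _ => ()) fun _ _ => rfl, delta] using h

theorem exists_isMinimizer (hm : 2 ≤ m) (p : PMF Ω) (Y : ∀ i, Ω → 𝒴 i) :
    ∃ P, IsMinimizer p Y P ∧ multiInfo p Y = delta p Y P := by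
  classical
  have hne : {P : Finpartition (Finset.univ : Finset (Fin m)) | 2 ≤ P.parts.card}.Nonempty :=
    -- The partition into singletons has `m ≥ 2` cells.
    ⟨⊥, by simpa [Finpartition.card_bot] using hm⟩
  obtain ⟨P, hP, hmin⟩ := Set.exists_min_image _ (delta p Y) (Set.toFinite _) hne
  refine ⟨P, ⟨hP, fun Q hQ => hmin Q hQ⟩, ?_⟩
  refine IsLeast.csInf_eq ⟨⟨P, hP, rfl⟩, ?_⟩
  rintro _ ⟨Q, hQ, rfl⟩
  exact hmin Q hQ

theorem multiInfo_nonneg (hm : 2 ≤ m) (p : PMF Ω) (Y : ∀ i, Ω → 𝒴 i) : 0 ≤ multiInfo p Y := by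
  obtain ⟨P, hP, h⟩ := exists_isMinimizer hm p Y
  exact h ▸ delta_nonneg p Y hP.1

end Multipartite

/-! ### The central estimate for interactive communication. -/

section Communication

variable {m n : ℕ} {𝒳 : Fin m → Type*}

/-- The first `k` transmissions of `c`, padded with zeros. -/
def InteractiveComm.initial (c : InteractiveComm 𝒳 n) (k : ℕ) (x : Obs 𝒳 n) : Fin c.r → ℕ :=
  fun j => if (j : ℕ) < k then c.F x j else 0

theorem InteractiveComm.initial_eq_iff {c : InteractiveComm 𝒳 n} {k : ℕ} {x y : Obs 𝒳 n} :
    c.initial k x = c.initial k y ↔ ∀ j : Fin c.r, (j : ℕ) < k → c.F x j = c.F y j := by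
  simp only [initial, funext_iff]
  refine forall_congr' fun j => ?_
  by_cases h : (j : ℕ) < k <;> simp [h]

theorem InteractiveComm.initial_r (c : InteractiveComm 𝒳 n) : c.initial c.r = c.F := by
  funext x j
  simp [initial]

variable [∀ i, Fintype (𝒳 i)]

/-- The transmissions of an interactive communication are, cell by cell, accounted for at most
`|P| - 1` times: each one is determined by the earlier ones and the cell of its sender. -/
theorem sum_condEntropy_comm_le (p : PMF (Obs 𝒳 n)) (c : InteractiveComm 𝒳 n)
    (P : Finpartition (Finset.univ : Finset (Fin m))) (hP : 2 ≤ P.parts.card) :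
    ∑ A ∈ P.parts, condEntropy p c.F (restr (𝒴 := fun i => Fin n → 𝒳 i) own A) ≤
      ((P.parts.card : ℝ) - 1) * entropy p c.F := by
  set X : ∀ A : Finset (Fin m), Obs 𝒳 n → ∀ i : A, Fin n → 𝒳 i := fun A => restr own A with hX
  have hP' : (2 : ℝ) ≤ P.parts.card := by exact_mod_cast hP
  suffices ∀ k ≤ c.r, ∑ A ∈ P.parts, condEntropy p (c.initial k) (X A) ≤
      ((P.parts.card : ℝ) - 1) * entropy p (c.initial k) by
    simpa only [c.initial_r] using this c.r le_rfl
  intro k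
  induction k with
  | zero =>
    intro _
    have h0 : ∀ x y, c.initial 0 x = c.initial 0 y := fun x y => by
      rw [InteractiveComm.initial_eq_iff]; intro j hj; omega
    rw [entropy_const p _ h0, mul_zero]
    refine Finset.sum_nonpos fun A _ => ?_
    have := condEntropy_le_entropy p (c.initial 0) (X A)
    rwa [entropy_const p _ h0] at this
  | succ k ih =>
    intro hk
    have ih := ih (by omega)
    set d := entropy p (c.initial (k + 1)) - entropy p (c.initial k) with hd
    have hsucc : ∀ x y, c.initial (k + 1) x = c.initial (k + 1) y →
        c.initial k x = c.initial k y := fun x y h => by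
      rw [InteractiveComm.initial_eq_iff] at h ⊢
      exact fun j hj => h j (by omega)
    -- A new transmission raises `H(· | X_A)` by at most its entropy `d` given the earlier ones, as
    -- conditioning reduces entropy.
    have hstep : ∀ A, condEntropy p (c.initial (k + 1)) (X A) ≤
        condEntropy p (c.initial k) (X A) + d := by
      intro A
      have h1 := entropy_submodular p (c.initial (k + 1)) (X A) (c.initial k)
      have h2 : entropy p (fun x => (c.initial (k + 1) x, X A x)) ≤
          entropy p (fun x => (c.initial (k + 1) x, X A x, c.initial k x)) :=
        entropy_mono p fun x y h => by
          simp only [Prod.mk.injEq] at h ⊢; exact ⟨h.1, h.2.1⟩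
      have h3 : entropy p (fun x => (c.initial (k + 1) x, c.initial k x)) ≤
          entropy p (c.initial (k + 1)) :=
        entropy_mono p fun x y h => by rw [Prod.mk.injEq]; exact ⟨h, hsucc _ _ h⟩
      have h4 : entropy p (fun x => (X A x, c.initial k x)) ≤
          entropy p (fun x => (c.initial k x, X A x)) :=
        entropy_mono p fun x y h => by
          simp only [Prod.mk.injEq] at h ⊢; exact h.symm
      simp only [condEntropy, hd]
      linarith
    obtain ⟨A₀, hA₀, hi⟩ := P.exists_mem (Finset.mem_univ (c.sender ⟨k, by omega⟩))
    -- The sender's cell sees no increase; this saves one `d` out of `|P|`.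
    have hstep₀ : condEntropy p (c.initial (k + 1)) (X A₀) ≤
        condEntropy p (c.initial k) (X A₀) := by
      refine sub_le_sub_right (entropy_mono p fun x y h => ?_) _
      simp only [Prod.mk.injEq] at h ⊢
      refine ⟨?_, h.2⟩
      have h1 := InteractiveComm.initial_eq_iff.1 h.1
      rw [InteractiveComm.initial_eq_iff]
      intro j hj
      rcases Nat.lt_succ_iff_lt_or_eq.1 hj with hj | hj
      · exact h1 j hj
      · obtain ⟨j, hjr⟩ := j
        obtain rfl : j = k := hj
        exact c.interactive _ x y (restr_eq_iff.1 h.2 _ hi) fun l hl => h1 l hl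
    have hrest := Finset.sum_le_sum fun A (_ : A ∈ P.parts.erase A₀) => hstep A
    rw [Finset.sum_add_distrib, Finset.sum_const, Finset.card_erase_of_mem hA₀, nsmul_eq_mul,
      Nat.cast_sub (by omega), Nat.cast_one] at hrest
    rw [← Finset.add_sum_erase _ _ hA₀] at ih ⊢
    have : ((P.parts.card : ℝ) - 1) * entropy p (c.initial (k + 1)) =
        ((P.parts.card : ℝ) - 1) * entropy p (c.initial k) + ((P.parts.card : ℝ) - 1) * d := by
      rw [hd]; ring
    linarith

/-- If every terminal recovers `J` from the communication up to an equivocation `η`, then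
`H(J | F)` is bounded by the multipartite information that `(J, F)` removes. -/
theorem entropy_pair_sub_le (p : PMF (Obs 𝒳 n)) (c : InteractiveComm 𝒳 n) {S : Type*}
    (J : Obs 𝒳 n → S) {P : Finpartition (Finset.univ : Finset (Fin m))}
    (hP : 2 ≤ P.parts.card) {η : ℝ} (h0 : 0 ≤ η)
    (hη : ∀ i, condEntropy p J (fun x => (own i x, c.F x)) ≤ η) :
    entropy p (fun x => (J x, c.F x)) - entropy p c.F ≤
      delta p own P - condDelta p own (fun x => (J x, c.F x)) P + 2 * η := by
  set X : ∀ A : Finset (Fin m), Obs 𝒳 n → ∀ i : A, Fin n → 𝒳 i := fun A => restr own A with hX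
  set L : Obs 𝒳 n → S × (Fin c.r → ℕ) := fun x => (J x, c.F x) with hL
  have hP' : (2 : ℝ) ≤ P.parts.card := by exact_mod_cast hP
  have hcell : ∀ A ∈ P.parts, entropy p (X A) - condEntropy p (X A) L ≥
      entropy p L - condEntropy p c.F (X A) - η := by
    intro A hA
    obtain ⟨i, hi⟩ := P.nonempty_of_mem_parts hA
    have h1 : condEntropy p J (fun x => (X A x, c.F x)) ≤ η :=
      (condEntropy_le_of_determines p J fun x y h => by
        simp only [Prod.mk.injEq] at h ⊢
        exact ⟨restr_eq_iff.1 h.1 i hi, h.2⟩).trans (hη i)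
    have h2 : entropy p (fun x => (X A x, L x)) = entropy p (fun x => (J x, X A x, c.F x)) :=
      entropy_congr p fun x y => by simp only [hL, Prod.mk.injEq]; tauto
    have h3 : entropy p (fun x => (c.F x, X A x)) = entropy p (fun x => (X A x, c.F x)) :=
      entropy_congr p fun x y => by simp only [Prod.mk.injEq]; tauto
    simp only [condEntropy] at h1 ⊢
    linarith
  have hsum := Finset.sum_le_sum hcell
  simp only [Finset.sum_sub_distrib, Finset.sum_const, nsmul_eq_mul] at hsum
  have hcomm : ∑ A ∈ P.parts, condEntropy p c.F (X A) ≤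
      ((P.parts.card : ℝ) - 1) * entropy p c.F := sum_condEntropy_comm_le p c P hP
  -- `X_M` determines `L`; this term removes one of the `|P|` copies of `H(L)`.
  have huniv : condEntropy p (X Finset.univ) L = entropy p (X Finset.univ) - entropy p L := by
    rw [condEntropy, sub_left_inj]
    refine entropy_congr p fun x y => ?_
    rw [Prod.mk.injEq]
    refine ⟨fun h => h.1, fun h => ⟨h, ?_⟩⟩
    have : x = y := by
      funext t i
      exact congrFun (restr_eq_iff.1 h i (Finset.mem_univ i)) t
    rw [this]
  have hdiff : delta p own P - condDelta p own L P =
      (∑ A ∈ P.parts, entropy p (X A) - ∑ A ∈ P.parts, condEntropy p (X A) L - entropy p L) /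
        ((P.parts.card : ℝ) - 1) := by
    rw [delta, condDelta, ← sub_div]
    congr 1
    change _ - entropy p (X Finset.univ) - (_ - condEntropy p (X Finset.univ) L) = _
    rw [huniv]
    ring
  -- The constant 2 arises here: `|P| η ≤ 2 (|P| - 1) η` because `|P| ≥ 2`.
  have hmul : 0 ≤ ((P.parts.card : ℝ) - 2) * η := mul_nonneg (by linarith) h0
  have : entropy p L - entropy p c.F - 2 * η ≤ delta p own P - condDelta p own L P := by
    rw [hdiff, le_div_iff₀ (by linarith)]
    linarith
  linarith

end Communication

/-! ### Entropy and `Δ` of i.i.d. blocks. -/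

section Memoryless

variable {m : ℕ} {𝒳 : Fin m → Type*} [∀ i, Fintype (𝒳 i)]

theorem iid_apply_toReal (p : PMF (∀ i, 𝒳 i)) (n : ℕ) (x : Obs 𝒳 n) :
    (iid p n x).toReal = ∏ t, (p (x t)).toReal := by
  simp [iid, PMF.ofFintype_apply, ENNReal.toReal_prod]

theorem sum_prod_obs {n : ℕ} (w : Fin n → (∀ i, 𝒳 i) → ℝ) :
    ∑ x : Obs 𝒳 n, ∏ t, w t (x t) = ∏ t, ∑ a, w t a := by
  classical
  rw [Finset.prod_univ_sum, Fintype.piFinset_univ]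

theorem prob_iid (p : PMF (∀ i, 𝒳 i)) (n : ℕ) {S : Type*} (f : (∀ i, 𝒳 i) → S)
    (s : Fin n → S) :
    prob (iid p n) (fun x => (fun t => f (x t)) = s) = ∏ t, prob p fun a => f a = s t := by
  classical
  simp only [prob_eq_sum_ite]
  rw [← sum_prod_obs]
  refine Finset.sum_congr rfl fun x _ => ?_
  rw [iid_apply_toReal, Fintype.prod_ite_zero]
  by_cases h : (fun t => f (x t)) = s
  · rw [if_pos h, if_pos fun t => congrFun h t]
  · rw [if_neg h, if_neg fun h' => h (funext h')]

theorem sum_iid_mul_apply (p : PMF (∀ i, 𝒳 i)) {n : ℕ} (φ : (∀ i, 𝒳 i) → ℝ) (t : Fin n) :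
    ∑ x : Obs 𝒳 n, (iid p n x).toReal * φ (x t) = ∑ a, (p a).toReal * φ a := by
  classical
  -- Writing `φ (x t)` as a product over all times lets the sum factor; every factor except the one
  -- at `t` is 1.
  calc _ = ∑ x : Obs 𝒳 n, ∏ s, (p (x s)).toReal * if s = t then φ (x s) else 1 := by
        refine Finset.sum_congr rfl fun x _ => ?_
        rw [Finset.prod_mul_distrib, iid_apply_toReal, Finset.prod_ite_eq']
        simp
    _ = ∏ s, ∑ a, (p a).toReal * if s = t then φ a else 1 :=
        sum_prod_obs fun s a => (p a).toReal * if s = t then φ a else 1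
    _ = ∑ a, (p a).toReal * φ a := by
        rw [Finset.prod_eq_single t]
        · simp
        · intro s _ hs
          simp [hs, sum_toReal_eq_one]
        · simp

theorem entropy_iid (p : PMF (∀ i, 𝒳 i)) (n : ℕ) {S : Type*} (f : (∀ i, 𝒳 i) → S) :
    entropy (iid p n) (fun x t => f (x t)) = n * entropy p f := by
  rw [entropy_eq_sum, entropy_eq_sum]
  calc _ = ∑ x : Obs 𝒳 n, ∑ t, (iid p n x).toReal *
        -Real.log (prob p fun a => f a = f (x t)) := by
        refine Finset.sum_congr rfl fun x _ => ?_
        rw [← Finset.mul_sum, prob_iid]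
        rcases (ENNReal.toReal_nonneg (a := iid p n x)).eq_or_lt with h0 | h0
        · simp [← h0]
        · rw [Real.log_prod, Finset.sum_neg_distrib]
          intro t ht
          have : (p (x t)).toReal ≠ 0 := by
            rw [iid_apply_toReal] at h0
            exact Finset.prod_ne_zero_iff.1 h0.ne' t ht
          exact ((lt_of_le_of_ne ENNReal.toReal_nonneg this.symm).trans_le
            (le_prob p (E := fun a => f a = f (x t)) rfl)).ne'
    _ = _ := by
        rw [Finset.sum_comm, Finset.sum_congr rfl fun t _ => sum_iid_mul_apply p
          (fun b => -Real.log (prob p fun a => f a = f b)) t]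
        simp

theorem delta_iid (p : PMF (∀ i, 𝒳 i)) (n : ℕ)
    (P : Finpartition (Finset.univ : Finset (Fin m))) :
    delta (iid p n) (own (𝒳 := 𝒳)) P = n * delta p (fun i (x : ∀ i, 𝒳 i) => x i) P := by
  have h : ∀ A : Finset (Fin m), entropy (iid p n) (restr own A) =
      n * entropy p (restr (fun i (x : ∀ i, 𝒳 i) => x i) A) := by
    intro A
    rw [← entropy_iid]
    refine entropy_congr _ fun x y => ?_
    rw [restr_eq_iff, funext_iff]
    exact ⟨fun h t => restr_eq_iff.2 fun i hi => congrFun (h i hi) t,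
      fun h i hi => funext fun t => restr_eq_iff.1 (h t) i hi⟩
  simp only [delta, h, ← Finset.mul_sum]
  rw [← mul_sub, mul_div_assoc]

theorem log_card_obs (𝒳 : Fin m → Type*) [∀ i, Fintype (𝒳 i)] (n : ℕ) :
    Real.log (Fintype.card (Obs 𝒳 n)) = n * Real.log (Fintype.card (∀ i, 𝒳 i)) := by
  classical
  rw [Fintype.card_fun, Fintype.card_fin, Nat.cast_pow, Real.log_pow]

end Memoryless

/-! ### Passing from one-block estimates to rates. -/

section Rates

variable {m : ℕ} {𝒳 : Fin m → Type*} [∀ i, Fintype (𝒳 i)]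

theorem condEntropy_le_of_recoverable {n : ℕ} (q : PMF (Obs 𝒳 n)) (c : InteractiveComm 𝒳 n)
    (J : Obs 𝒳 n → ℕ) {ε : ℝ} (g : ∀ i : Fin m, (Fin n → 𝒳 i) → (Fin c.r → ℕ) → ℕ)
    (hg : 1 - ε ≤ prob q fun x => ∀ i, g i (own i x) (c.F x) = J x) (i : Fin m) :
    condEntropy q J (fun x => (own i x, c.F x)) ≤
      Real.log 2 + ε * (n * Real.log (Fintype.card (∀ i, 𝒳 i))) := by
  classical
  have h := condEntropy_le_of_prob_error q J (fun x => (own i x, c.F x))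
    (fun x => ¬ ∀ i, g i (own i x) (c.F x) = J x) (fun x y hx hy hxy => by
      rw [not_not] at hx hy
      rw [Prod.mk.injEq] at hxy
      rw [← hx i, ← hy i, hxy.1, hxy.2])
  have h1 := prob_add_prob_not q fun x => ∀ i, g i (own i x) (c.F x) = J x
  rw [log_card_obs] at h
  refine h.trans (add_le_add_right (mul_le_mul_of_nonneg_right (by linarith) ?_) _)
  exact mul_nonneg (Nat.cast_nonneg _) (Real.log_natCast_nonneg _)

theorem exists_delta_iid_eq (hm : 2 ≤ m) (p : PMF (∀ i, 𝒳 i)) (n : ℕ) :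
    ∃ P : Finpartition (Finset.univ : Finset (Fin m)), 2 ≤ P.parts.card ∧
      delta (iid p n) (own (𝒳 := 𝒳)) P = n * sourceInfo p := by
  obtain ⟨P, hP, h⟩ := exists_isMinimizer hm p fun i (x : ∀ i, 𝒳 i) => x i
  exact ⟨P, hP.1, by rw [delta_iid, sourceInfo, h]⟩

theorem entropy_pair_le_of_recoverable (hm : 2 ≤ m) (p : PMF (∀ i, 𝒳 i)) {n : ℕ} (hn : n ≠ 0)
    (c : InteractiveComm 𝒳 n) (J : Obs 𝒳 n → ℕ) {ε : ℝ} (hε : 0 ≤ ε)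
    (g : ∀ i : Fin m, (Fin n → 𝒳 i) → (Fin c.r → ℕ) → ℕ)
    (hg : 1 - ε ≤ prob (iid p n) fun x => ∀ i, g i (own i x) (c.F x) = J x) :
    entropy (iid p n) (fun x => (J x, c.F x)) / n ≤ commRate p c + sourceInfo p +
      2 * (Real.log 2 / n + ε * Real.log (Fintype.card (∀ i, 𝒳 i))) := by
  obtain ⟨P, hP, hδ⟩ := exists_delta_iid_eq hm p n
  have hK := Real.log_natCast_nonneg (Fintype.card (∀ i, 𝒳 i))
  have h := entropy_pair_sub_le (iid p n) c J hP (by positivity)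
    (condEntropy_le_of_recoverable (iid p n) c J g hg)
  have h1 := condDelta_nonneg (iid p n) own (fun x => (J x, c.F x)) hP
  have h2 := entropy_le_log_ncard (iid p n) c.F
  have hn' : (0 : ℝ) < n := by positivity
  rw [hδ] at h
  rw [div_le_iff₀ hn']
  have e : (commRate p c + sourceInfo p +
      2 * (Real.log 2 / n + ε * Real.log (Fintype.card (∀ i, 𝒳 i)))) * n =
      Real.log ((c.F '' (iid p n).support).ncard : ℝ) + n * sourceInfo p +
      2 * (Real.log 2 + ε * (n * Real.log (Fintype.card (∀ i, 𝒳 i)))) := by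
    rw [commRate]; field_simp
  rw [e]
  linarith

theorem condMultiInfo_nonneg {Ω : Type*} [Fintype Ω] {𝒴 : Fin m → Type*} {S : Type*} (p : PMF Ω)
    (Y : ∀ i, Ω → 𝒴 i) (L : Ω → S) : 0 ≤ condMultiInfo p Y L := by
  refine Real.sSup_nonneg ?_
  rintro _ ⟨P, hP, rfl⟩
  exact condDelta_nonneg p Y L hP.1

/-- Secrecy and rate give `H(K | F) ≥ n (I(X_M) - ε) - ε`, while any block minimizer has `Δ(P) ≤ n
I(X_M)`. The central estimate then leaves little room for `Δ(P | K, F)`, whichever minimizer attains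
the maximum. -/
theorem condMultiInfo_iid_le (hm : 2 ≤ m) (p : PMF (∀ i, 𝒳 i)) {n : ℕ} (hn : n ≠ 0)
    (c : InteractiveComm 𝒳 n) (K : Obs 𝒳 n → ℕ) {ε : ℝ} (hε : 0 ≤ ε)
    (g : ∀ i : Fin m, (Fin n → 𝒳 i) → (Fin c.r → ℕ) → ℕ)
    (hg : 1 - ε ≤ prob (iid p n) fun x => ∀ i, g i (own i x) (c.F x) = K x)
    (hsec : mutualInfo (iid p n) K c.F ≤ ε)
    (hrate : sourceInfo p - ε ≤ entropy (iid p n) K / n) :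
    condMultiInfo (iid p n) own (fun x => (K x, c.F x)) / n ≤
      ε + ε / n + 2 * (Real.log 2 / n + ε * Real.log (Fintype.card (∀ i, 𝒳 i))) := by
  have hK := Real.log_natCast_nonneg (Fintype.card (∀ i, 𝒳 i))
  have hn' : (0 : ℝ) < n := by positivity
  rw [div_le_iff₀ hn']
  refine Real.sSup_le ?_ (by positivity)
  rintro _ ⟨P, hP, rfl⟩
  obtain ⟨Q, hQ, hδ⟩ := exists_delta_iid_eq hm p n
  have hPQ := hP.2 Q hQ
  have h := entropy_pair_sub_le (iid p n) c K hP.1 (by positivity)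
    (condEntropy_le_of_recoverable (iid p n) c K g hg)
  rw [le_div_iff₀ hn'] at hrate
  simp only [mutualInfo, condEntropy] at hsec
  have e : (ε + ε / n + 2 * (Real.log 2 / n + ε * Real.log (Fintype.card (∀ i, 𝒳 i)))) * n =
      n * ε + ε + 2 * (Real.log 2 + ε * (n * Real.log (Fintype.card (∀ i, 𝒳 i)))) := by
    field_simp
  rw [e]
  linarith

/-- At each `n`, use the largest level `k ≤ n` whose threshold `N k` has been passed. -/
theorem exists_diagonal {α : ℕ → Type*} [∀ n, Nonempty (α n)] (Q : ∀ n, ℕ → α n → Prop)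
    (h : ∀ k, ∀ᶠ n in atTop, ∃ a, Q n k a) :
    ∃ (a : ∀ n, α n) (κ : ℕ → ℕ), Tendsto κ atTop atTop ∧ ∀ᶠ n in atTop, Q n (κ n) (a n) := by
  classical
  simp only [eventually_atTop] at h
  choose N hN using h
  set κ : ℕ → ℕ := fun n => Nat.findGreatest (fun k => N k ≤ n) n
  have hκ : ∀ n, N 0 ≤ n → N (κ n) ≤ n := fun n hn =>
    Nat.findGreatest_spec (P := fun k => N k ≤ n) (Nat.zero_le n) hn
  refine ⟨fun n => if hn : N 0 ≤ n then (hN (κ n) n (hκ n hn)).choose else Classical.arbitrary _,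
    κ, tendsto_atTop.2 fun k => ?_, ?_⟩
  · filter_upwards [eventually_ge_atTop k, eventually_ge_atTop (N k)] with n h1 h2
    exact Nat.le_findGreatest h1 h2
  · filter_upwards [eventually_ge_atTop (N 0)] with n hn
    rw [dif_pos hn]
    exact (hN (κ n) n (hκ n hn)).choose_spec

/-- For a fixed tolerance, the key only bounds the normalized conditional information by a multiple
of that tolerance, whereas a CI needs limit 0. Diagonalizing over tolerances yields one sequence
that serves every `ε`. -/
theorem AchievableRSK.achievableRCI (hm : 2 ≤ m) {p : PMF (∀ i, 𝒳 i)} {R : ℝ}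
    (h : AchievableRSK p R) : AchievableRCI p R := by
  obtain ⟨hR, h⟩ := h
  obtain ⟨c₀, K₀, -⟩ := h 1 one_pos
  have : ∀ n, Nonempty (InteractiveComm 𝒳 n × (Obs 𝒳 n → ℕ)) := fun n => ⟨c₀ n, K₀ n⟩
  -- Starting at 1/2 keeps each tolerance strictly below 1, as `IsCR` requires.
  set u : ℕ → ℝ := fun k => 1 / ((k : ℝ) + 1 + 1) with hu
  have hu0 : ∀ k, 0 < u k := fun k => by positivity
  have hu1 : ∀ k, u k < 1 := fun k => by
    rw [hu, div_lt_one (by positivity)]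
    have : (0 : ℝ) ≤ k := Nat.cast_nonneg k
    linarith
  have hulim : Tendsto u atTop (𝓝 0) := by
    have := (tendsto_add_atTop_iff_nat 1).2 (tendsto_one_div_add_atTop_nhds_zero_nat (𝕜 := ℝ))
    simpa only [Nat.cast_add, Nat.cast_one] using this
  obtain ⟨a, κ, hκ, ha⟩ := exists_diagonal
    (fun n k (a : InteractiveComm 𝒳 n × (Obs 𝒳 n → ℕ)) =>
      (∃ g : ∀ i : Fin m, (Fin n → 𝒳 i) → (Fin a.1.r → ℕ) → ℕ,
        1 - u k ≤ prob (iid p n) fun x => ∀ i, g i (own i x) (a.1.F x) = a.2 x) ∧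
      mutualInfo (iid p n) a.2 a.1.F ≤ u k ∧ commRate p a.1 ≤ R + u k ∧
      sourceInfo p - u k ≤ entropy (iid p n) a.2 / n) (fun k => by
        obtain ⟨c, K, ⟨hCR, hsec⟩, hrate⟩ := h (u k) (hu0 k)
        filter_upwards [hCR (u k) (hu0 k) (hu1 k), hsec (u k) (hu0 k), hrate] with n h1 h2 h3
        exact ⟨(c n, K n), h1, h2, h3.1, h3.2⟩)
  have hε : Tendsto (fun n => u (κ n)) atTop (𝓝 0) := hulim.comp hκ
  have hinv : ∀ C : ℝ, Tendsto (fun n : ℕ => C / n) atTop (𝓝 0) :=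
    tendsto_const_div_atTop_nhds_zero_nat
  refine ⟨hR, fun ε hε0 => ⟨fun n => (a n).1, fun n => (a n).2, ⟨?_, ?_⟩, ?_⟩⟩
  · intro δ hδ _
    filter_upwards [ha, hε.eventually_le_const hδ] with n hn hδn
    obtain ⟨g, hg⟩ := hn.1
    exact ⟨g, by linarith⟩
  · have hlim : Tendsto (fun n : ℕ => u (κ n) + 1 / n +
        2 * (Real.log 2 / n + u (κ n) * Real.log (Fintype.card (∀ i, 𝒳 i)))) atTop (𝓝 0) := by
      simpa using (hε.add (hinv 1)).add (((hinv (Real.log 2)).add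
        (hε.mul_const (Real.log (Fintype.card (∀ i, 𝒳 i))))).const_mul 2)
    refine tendsto_of_tendsto_of_tendsto_of_le_of_le' tendsto_const_nhds hlim
      (Eventually.of_forall fun n => div_nonneg (condMultiInfo_nonneg _ _ _) (Nat.cast_nonneg n)) ?_
    filter_upwards [ha, eventually_ne_atTop 0] with n hn hn0
    obtain ⟨⟨g, hg⟩, hsec, -, hrate⟩ := hn
    refine (condMultiInfo_iid_le hm p hn0 _ _ (hu0 _).le g hg hsec hrate).trans ?_
    have : u (κ n) / n ≤ 1 / n := div_le_div_of_nonneg_right (hu1 _).le (Nat.cast_nonneg n)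
    linarith
  · filter_upwards [ha, hε.eventually_le_const hε0] with n hn hεn
    linarith [hn.2.2.1]

/-- The slack `ε` stays because `AchievableRCI` allows a different CI for each `ε`, while
`AchievableCI` asks for a single one. -/
theorem AchievableRCI.achievableCI (hm : 2 ≤ m) {p : PMF (∀ i, 𝒳 i)} {R : ℝ}
    (h : AchievableRCI p R) {ε : ℝ} (hε : 0 < ε) : AchievableCI p (R + sourceInfo p + ε) := by
  obtain ⟨hR, h⟩ := h
  obtain ⟨c, J, hCI, hrate⟩ := h ε hε
  have hI : 0 ≤ sourceInfo p := multiInfo_nonneg hm p _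
  have hK := Real.log_natCast_nonneg (Fintype.card (∀ i, 𝒳 i))
  refine ⟨by positivity, c, J, hCI, fun δ hδ => ?_⟩
  set K := Real.log (Fintype.card (∀ i, 𝒳 i))
  obtain ⟨θ, hθ0, hθ1, hθK⟩ : ∃ θ : ℝ, 0 < θ ∧ θ < 1 ∧ 2 * (θ * K) ≤ δ / 2 := by
    -- `K + 1` instead of `K` covers `K = 0`, when the alphabet product is a single point.
    refine ⟨min (1 / 2) (δ / (4 * (K + 1))), by positivity,
      (min_le_left _ _).trans_lt (by norm_num), ?_⟩
    have h1 : min (1 / 2) (δ / (4 * (K + 1))) * (K + 1) ≤ δ / (4 * (K + 1)) * (K + 1) :=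
      mul_le_mul_of_nonneg_right (min_le_right _ _) (by linarith)
    have h2 : δ / (4 * (K + 1)) * (K + 1) = δ / 4 := by field_simp
    have h3 : 0 < min (1 / 2) (δ / (4 * (K + 1))) := by positivity
    linarith
  have hlog : ∀ᶠ n : ℕ in atTop, Real.log 2 / n ≤ δ / 4 :=
    (tendsto_const_div_atTop_nhds_zero_nat (Real.log 2)).eventually_le_const (by positivity)
  filter_upwards [hrate, hlog, hCI.1 θ hθ0 hθ1, eventually_ne_atTop 0] with n h1 h2 h3 hn
  obtain ⟨g, hg⟩ := h3
  have h4 := entropy_pair_le_of_recoverable hm p hn (c n) (J n) hθ0.le g hg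
  change entropy (iid p n) (fun x => (J n x, (c n).F x)) / n ≤ _
  linarith

theorem RCI_le_RSK (hm : 2 ≤ m) (p : PMF (∀ i, 𝒳 i)) : RCI p ≤ RSK p :=
  sInf_le_sInf fun _ ⟨R, hR, e⟩ => ⟨R, hR.achievableRCI hm, e⟩

theorem CIrate_sub_sourceInfo_le_RCI (hm : 2 ≤ m) (p : PMF (∀ i, 𝒳 i)) :
    CIrate p - (sourceInfo p : EReal) ≤ RCI p := by
  refine le_sInf ?_
  rintro _ ⟨R, hR, rfl⟩
  have hCI : ∀ ε : ℝ, 0 < ε → CIrate p ≤ ((R + sourceInfo p + ε : ℝ) : EReal) := fun ε hε =>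
    sInf_le ⟨_, hR.achievableCI hm hε, rfl⟩
  -- `sourceInfo p` is finite, so it can be moved across; the slack `ε` then vanishes by density of
  -- the reals in `EReal`.
  rw [EReal.sub_le_iff_le_add (Or.inl (EReal.coe_ne_bot _)) (Or.inl (EReal.coe_ne_top _)),
    ← EReal.coe_add]
  refine EReal.le_of_forall_lt_iff_le.1 fun z hz => ?_
  have hz' : R + sourceInfo p < z := EReal.coe_lt_coe_iff.1 hz
  simpa using hCI (z - (R + sourceInfo p)) (by linarith)

end Rates

end MTSource

/-- For every multiterminal source `X_M` with `m ≥ 2` terminals and finite alphabets,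
`R_SK ≥ R_CI ≥ CI(X_M) - I(X_M)`. -/
theorem theorem1 {m : ℕ} (hm : 2 ≤ m) {𝒳 : Fin m → Type*} [∀ i, Fintype (𝒳 i)]
    (p : PMF (∀ i, 𝒳 i)) :
    MTSource.RSK p ≥ MTSource.RCI p ∧
      MTSource.RCI p ≥ MTSource.CIrate p - (MTSource.sourceInfo p : EReal) :=
  ⟨MTSource.RCI_le_RSK hm p, MTSource.CIrate_sub_sourceInfo_le_RCI hm p⟩
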